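/- Let $T$ be a theory (a set of first-order sentences) over a signature $\Sigma$ of function symbols (constants being the $0$-ary ones) and predicate symbols. Assume that $T$ is universal, i.e. has an axiomatization by universal sentences, and that $T$ allows quantifier elimination, i.e. every first-order formula $\varphi$ over $\Sigma$ is equivalent modulo $T$ to some quantifier-free formula over $\Sigma$. Structures are nonempty, as usual. For a signature $\Sigma'$ disjoint from $\Sigma$, let $T\cup\mathsf{UIF}_{\Sigma'}$ be the theory $T$ regarded over $\Sigma\cup\Sigma'$, the symbols of $\Sigma'$ being uninterpreted. A ground formula is a quantifier-free formula without variables. For ground $\Sigma\cup\Sigma'$-formulas $A,B$, a *general ground interpolant* of $A$ and $B$ is a ground $\Sigma\cup\Sigma'$-formula $I$ such that (i) all constants, function symbols and predicate symbols from $\Sigma'$ that occur in $I$ occur both in $A$ and in $B$ (symbols from $\Sigma$ are unrestricted), and (ii) $A\models_{T\cup\mathsf{UIF}_{\Sigma'}} I$ and $B\wedge I\models_{T\cup\mathsf{UIF}_{\Sigma'}}\bot$. The theory $T$ has *general ground interpolation* if for every signature $\Sigma'$ disjoint from $\Sigma$ and all ground $\Sigma\cup\Sigma'$-formulas $A,B$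 with $A\wedge B\models_{T\cup\mathsf{UIF}_{\Sigma'}}\bot$ there is a general ground interpolant of $A$ and $B$. 1. If $\Sigma$ contains at least one constant symbol, then $T$ has general ground interpolation. 2. Whether or not $\Sigma$ contains a constant symbol, for every signature $\Sigma'$ disjoint from $\Sigma$ and all ground $\Sigma\cup\Sigma'$-formulas $A,B$ such that some constant of $\Sigma'$ occurs both in $A$ and in $B$ and $A\wedge B\models_{T\cup\mathsf{UIF}_{\Sigma'}}\bot$, there is a general ground interpolant of $A$ and $B$. -/

import Mathlib

open FirstOrder

universe u v w u' v'

namespace GroundInterpolation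

open FirstOrder.Language

section Symbols

variable {L : FirstOrder.Language.{u, v}} {α : Type w}

/-- The function symbols (constants being the symbols of arity `0`) that occur in a term. -/
def termFunctions : L.Term α → Set (Σ n, L.Functions n)
  | .var _ => ∅
  | .func f ts => insert ⟨_, f⟩ (⋃ i, termFunctions (ts i))

/-- The function symbols (constants being the symbols of arity `0`) that occur in a formula. -/
def formulaFunctions : ∀ {n : ℕ}, L.BoundedFormula α n → Set (Σ n, L.Functions n)
  | _, .falsum => ∅
  | _, .equal t₁ t₂ => termFunctions t₁ ∪ termFunctions t₂
  | _, .rel _ ts => ⋃ i, termFunctions (ts i)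
  | _, .imp φ ψ => formulaFunctions φ ∪ formulaFunctions ψ
  | _, .all φ => formulaFunctions φ

/-- The predicate symbols (other than equality) that occur in a formula. -/
def formulaRelations : ∀ {n : ℕ}, L.BoundedFormula α n → Set (Σ n, L.Relations n)
  | _, .falsum => ∅
  | _, .equal _ _ => ∅
  | _, .rel R _ => {⟨_, R⟩}
  | _, .imp φ ψ => formulaRelations φ ∪ formulaRelations ψ
  | _, .all φ => formulaRelations φ

end Symbols

section Theories

variable {L : FirstOrder.Language.{u, v}}

/-- `T` is a universal theory: it has an axiomatization by universal sentences, i.e. it is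
logically equivalent to a set `U` of universal sentences. -/
def IsUniversalTheory (T : L.Theory) : Prop :=
  ∃ U : L.Theory, U.IsUniversal ∧ (∀ φ ∈ U, T ⊨ᵇ φ) ∧ (∀ φ ∈ T, U ⊨ᵇ φ)

/-- `T` allows quantifier elimination: every formula is equivalent modulo `T` to a
quantifier-free formula. Variables are indexed by `ℕ`. -/
def AllowsQuantifierElimination (T : L.Theory) : Prop :=
  ∀ φ : L.Formula ℕ, ∃ ψ : L.Formula ℕ, ψ.IsQF ∧ T ⊨ᵇ φ.iff ψ

/-- A ground formula: a quantifier-free formula without variables. -/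
def IsGround (φ : L.Sentence) : Prop := BoundedFormula.IsQF φ

/-- `F ⊨_T G`: every model of `T` in which `F` is true is a model of `G`. -/
def Entails (T : L.Theory) (F G : L.Sentence) : Prop :=
  T ⊨ᵇ BoundedFormula.imp F G

/-- `T ∪ UIF_Σ'`: the theory `T`, regarded as a theory over the disjoint union of its signature `L`
with a signature `L'` of uninterpreted symbols. -/
def withUIF (T : L.Theory) (L' : FirstOrder.Language.{u', v'}) : (L.sum L').Theory :=
  (LHom.sumInl : L →ᴸ L.sum L').onTheory T

/-- `I` is a general ground interpolant of `A` and `B` with respect to `T ∪ UIF_Σ'`: it is ground,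
the symbols of `L'` (constants, functions, predicates) that occur in it occur both in `A` and
in `B`, and it is entailed by `A` and inconsistent with `B`. Symbols of `L` are unrestricted. -/
structure IsGeneralGroundInterpolant (T : L.Theory) (L' : FirstOrder.Language.{u', v'})
    (A B I : (L.sum L').Sentence) : Prop where
  ground : IsGround I
  functions_common : ∀ (n : ℕ) (f : L'.Functions n),
    (⟨n, Sum.inr f⟩ : Σ n, (L.sum L').Functions n) ∈ formulaFunctions I →
      (⟨n, Sum.inr f⟩ : Σ n, (L.sum L').Functions n) ∈ formulaFunctions A ∩ formulaFunctions B
  relations_common : ∀ (n : ℕ) (R : L'.Relations n),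
    (⟨n, Sum.inr R⟩ : Σ n, (L.sum L').Relations n) ∈ formulaRelations I →
      (⟨n, Sum.inr R⟩ : Σ n, (L.sum L').Relations n) ∈ formulaRelations A ∩ formulaRelations B
  entailed : Entails (withUIF T L') A I
  inconsistent : Entails (withUIF T L') (B ⊓ I) ⊥

/-- `T` has general ground interpolation. -/
def HasGeneralGroundInterpolation (T : L.Theory) : Prop :=
  ∀ (L' : FirstOrder.Language.{u', v'}) (A B : (L.sum L').Sentence), IsGround A → IsGround B →
    Entails (withUIF T L') (A ⊓ B) ⊥ →
      ∃ I : (L.sum L').Sentence, IsGeneralGroundInterpolant T L' A B I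

/-- Some constant symbol of `L'` occurs both in `A` and in `B`. -/
def ShareConstant (L' : FirstOrder.Language.{u', v'}) (A B : (L.sum L').Sentence) : Prop :=
  ∃ c : L'.Constants,
    (⟨0, Sum.inr c⟩ : Σ n, (L.sum L').Functions n) ∈ formulaFunctions A ∩ formulaFunctions B

end Theories

end GroundInterpolation

/-! Suppose that no interpolant exists. By compactness (`exists_models_of_not_separated`) there are
models M of A and N of B that satisfy the same ground formulas over the symbols of Σ and the common
symbols of Σ'. The values in N of closed terms over these symbols form a Σ-substructure S. It is
nonempty because of the constant, it is a model of T because T is universal, and it embeds into M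
because the ground formulas agree.

Quantifier elimination makes embeddings between models elementary, so M and N can be amalgamated in
a model D of T with images meeting only in S (`exists_strong_amalgam`). Since the overlap consists
of values of common terms, the interpretations of Σ' needed for A on M and for B on N do not
conflict, and they extend to D (`exists_common_expansion`). Quantifier-free truth is preserved, so D
satisfies both A and B, a contradiction. -/

namespace GroundInterpolation

open FirstOrder.Language Filter

/-! ### Quantifier elimination and embeddings -/

section QuantifierElimination

variable {L : FirstOrder.Language.{u, v}} {T : L.Theory}

/-- Over a nonempty index type, every formula is the substitution instance of a formula with
variables indexed by `ℕ`. -/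
theorem exists_formula_nat {α : Type*} [Nonempty α] (φ : L.Formula α) :
    ∃ (ψ : L.Formula ℕ) (g : ℕ → α), ∀ (M : Type w) [L.Structure M] (x : α → M),
      ψ.Realize (x ∘ g) ↔ φ.Realize x := by
  classical
  obtain ⟨e, he⟩ := Countable.exists_injective_nat φ.freeVarFinset
  refine ⟨φ.restrictFreeVar e,
    fun k => if h : ∃ a, e a = k then (h.choose : α) else Classical.arbitrary α,
    fun M _ x => BoundedFormula.realize_restrictFreeVar x fun a => ?_⟩
  have h : ∃ b, e b = e a := ⟨a, rfl⟩
  simp only [Function.comp_apply, dif_pos h, he h.choose_spec]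

/-- In the presence of quantifier elimination, embeddings between models are elementary. -/
theorem AllowsQuantifierElimination.realize_embedding (hQE : AllowsQuantifierElimination T)
    {M N : Type w} [L.Structure M] [L.Structure N] [Nonempty M] [Nonempty N] [M ⊨ T] [N ⊨ T]
    (f : M ↪[L] N) {α : Type*} [Nonempty α] (φ : L.Formula α) (x : α → M) :
    φ.Realize (f ∘ x) ↔ φ.Realize x := by
  obtain ⟨ψ, g, hg⟩ := exists_formula_nat.{u, v, w} φ
  obtain ⟨θ, hθ, h⟩ := hQE ψ
  rw [← hg, ← hg, Function.comp_assoc]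
  have hM : ψ.Realize (x ∘ g) ↔ θ.Realize (x ∘ g) :=
    Formula.realize_iff.1 (h.realize_formula M)
  have hN : ψ.Realize (f ∘ x ∘ g) ↔ θ.Realize (f ∘ x ∘ g) :=
    Formula.realize_iff.1 (h.realize_formula N)
  rw [hM, hN, Formula.Realize, Formula.Realize, ← hθ.realize_embedding f,
    Subsingleton.elim (f ∘ default) default]

/-- A formula with parameters that holds in a model is satisfied by elements of any submodel,
with the parameters from the submodel kept fixed. -/
theorem AllowsQuantifierElimination.exists_realize_substructure
    (hQE : AllowsQuantifierElimination T) {N : Type w} [L.Structure N] [N ⊨ T]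
    (S : L.Substructure N) [Nonempty S] [S ⊨ T] (φ : L.Formula N)
    (hφ : φ.Realize (id : N → N)) :
    ∃ x : N → S, (∀ a : S, x a = a) ∧ φ.Realize x := by
  classical
  have : Nonempty N := ‹Nonempty S›.map Subtype.val
  -- Parameters in S are kept; those outside become variables, quantified existentially in ψ. So ψ
  -- holds in N and descends to S.
  let e : φ.freeVarFinset → S ⊕ φ.freeVarFinset :=
    fun a => if h : (a : N) ∈ S then Sum.inl ⟨a, h⟩ else Sum.inr a
  let ψ : L.Formula S := Formula.iExs φ.freeVarFinset (φ.restrictFreeVar e)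
  have hN : ψ.Realize (S.subtype ∘ id) := by
    refine Formula.realize_iExs.2 ⟨fun a => a, ?_⟩
    refine (BoundedFormula.realize_restrictFreeVar id fun a => ?_).2 hφ
    by_cases h : (a : N) ∈ S <;> simp [e, h]
  obtain ⟨y, hy⟩ := Formula.realize_iExs.1 ((hQE.realize_embedding S.subtype ψ id).1 hN)
  refine ⟨fun a => if h : a ∈ S then ⟨a, h⟩ else
    if h' : a ∈ φ.freeVarFinset then y ⟨a, h'⟩ else Classical.arbitrary S, by simp, ?_⟩
  refine (BoundedFormula.realize_restrictFreeVar _ fun a => ?_).1 hy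
  by_cases h : (a : N) ∈ S <;> simp [e, h]

end QuantifierElimination

/-! ### Strong amalgamation by an ultrapower -/

section Amalgamation

variable {L : FirstOrder.Language.{u, v}} {T : L.Theory}

/-- A map that preserves the truth of all formulas is an embedding. -/
theorem exists_embedding_of_realize {M N : Type w} [L.Structure M] [L.Structure N] (f : M → N)
    (hf : ∀ φ : L.Formula M, φ.Realize (id : M → M) → φ.Realize f) :
    ∃ g : M ↪[L] N, ∀ a, g a = f a := by
  have hf' : ∀ φ : L.Formula M, φ.Realize f ↔ φ.Realize (id : M → M) := fun φ =>
    ⟨fun h => by_contra fun h' => hf φ.not h' h, hf φ⟩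
  refine ⟨⟨⟨f, fun a b hab => ?_⟩, fun F x => ?_, fun R x => ?_⟩, fun _ => rfl⟩
  · have := (hf' (Term.equal (.var a) (.var b))).1
    simp only [Formula.realize_equal, Term.realize_var, id] at this
    exact this hab
  · have := hf (Term.equal (.var (Structure.funMap F x)) (.func F fun i => .var (x i)))
    simp only [Formula.realize_equal, Term.realize_var, Term.realize_func, id] at this
    exact this trivial
  · have := hf' (R.formula fun i => .var (x i))
    simp only [Formula.realize_rel, Term.realize_var, id] at this
    exact this

/-- Strong amalgamation: two models of a theory with quantifier elimination can be amalgamated over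
a common submodel so that their images meet only in that submodel. -/
theorem AllowsQuantifierElimination.exists_strong_amalgam (hQE : AllowsQuantifierElimination T)
    {M N : Type w} [L.Structure M] [L.Structure N] [M ⊨ T] [N ⊨ T]
    (S : L.Substructure N) [Nonempty S] [S ⊨ T] (h : S ↪[L] M) :
    ∃ (D : Type w) (_ : L.Structure D) (f : N ↪[L] D) (g : M ↪[L] D), D ⊨ T ∧
      (∀ a : S, f a = g (h a)) ∧ ∀ b m, f b = g m → ∃ a : S, (a : N) = b ∧ h a = m := by
  classical
  have : Nonempty M := ‹Nonempty S›.map h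
  have : Nonempty N := ‹Nonempty S›.map Subtype.val
  -- The amalgam is an ultrapower of M indexed by maps x : N → S. The ultrafilter contains every X
  -- φ, so b ↦ [x ↦ h (x b)] preserves whatever holds in N, while M embeds diagonally.
  let I := {φ : L.Formula N // φ.Realize (id : N → N)}
  let X : I → Set (N → S) := fun φ => {x | (∀ a : S, x a = a) ∧ φ.1.Realize (h ∘ x)}
  have : Nonempty I := ⟨⟨⊤, BoundedFormula.realize_top.2 trivial⟩⟩
  have : NeBot (⨅ φ, 𝓟 (X φ)) := by
    refine iInf_neBot_of_directed (fun φ ψ => ⟨⟨φ.1 ⊓ ψ.1, Formula.realize_inf.2 ⟨φ.2, ψ.2⟩⟩,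
      ?_, ?_⟩) fun φ => ?_
    · exact principal_mono.2 fun x hx => ⟨hx.1, (Formula.realize_inf.1 hx.2).1⟩
    · exact principal_mono.2 fun x hx => ⟨hx.1, (Formula.realize_inf.1 hx.2).2⟩
    · obtain ⟨x, hx, hφ⟩ := hQE.exists_realize_substructure S φ.1 φ.2
      exact principal_neBot_iff.2 ⟨x, hx, (hQE.realize_embedding h φ.1 x).2 hφ⟩
  let U : Ultrafilter (N → S) := Ultrafilter.of (⨅ φ, 𝓟 (X φ))
  have hU : ∀ φ : I, ∀ᶠ x in (U : Filter (N → S)), x ∈ X φ := fun φ =>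
    Ultrafilter.of_le _ (mem_iInf_of_mem φ (mem_principal_self _))
  have hfix : ∀ᶠ x in (U : Filter (N → S)), ∀ a : S, x a = a :=
    (hU ⟨⊤, BoundedFormula.realize_top.2 trivial⟩).mono fun x hx => hx.1
  let D := (U : Filter (N → S)).Product fun _ => M
  obtain ⟨f, hf⟩ := exists_embedding_of_realize (L := L)
    (fun b => ((fun x => h (x b) : (N → S) → M) : D)) fun φ hφ =>
      (Ultraproduct.realize_formula_cast φ fun b x => h (x b)).2 ((hU ⟨φ, hφ⟩).mono fun x hx => hx.2)
  obtain ⟨g, hg⟩ := exists_embedding_of_realize (L := L)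
    (fun m => ((fun _ => m : (N → S) → M) : D)) fun φ hφ =>
      (Ultraproduct.realize_formula_cast φ fun m _ => m).2 (Eventually.of_forall fun _ => hφ)
  have hfg : ∀ a : S, f a = g (h a) := fun a => by
    rw [hf, hg]
    exact Quotient.sound' (hfix.mono fun x hx => congrArg h (hx a))
  refine ⟨D, inferInstance, f, g, ?_, hfg, fun b m hbm => ?_⟩
  · exact T.model_iff.2 fun φ hφ => (Ultraproduct.sentence_realize φ).2
      (Eventually.of_forall fun _ => Theory.realize_sentence_of_mem T hφ)
  -- The representatives of f b take values in h(S), so meeting the constant m at a single index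
  -- already puts m in h(S).
  · obtain ⟨x, hx⟩ := (show ∀ᶠ x in (U : Filter (N → S)), h (x b) = m from
      Quotient.exact' ((hf b).symm.trans (hbm.trans (hg m)))).exists
    exact ⟨x b, f.injective ((hfg _).trans ((congrArg g hx).trans hbm.symm)), hx⟩

end Amalgamation

/-! ### Ground formulas, compactness and closed terms -/

section Ground

variable {K : FirstOrder.Language.{u, v}} {F : Set (Σ n, K.Functions n)}
  {R : Set (Σ n, K.Relations n)} {M N : Type w} [K.Structure M] [K.Structure N]

/-- `g` is an embedding for the function symbols in `F` and the predicate symbols in `R`. -/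
structure IsEmbeddingOn (F : Set (Σ n, K.Functions n)) (R : Set (Σ n, K.Relations n))
    (g : M → N) : Prop where
  injective : Function.Injective g
  map_fun : ∀ (n : ℕ) (f : K.Functions n), ⟨n, f⟩ ∈ F → ∀ x : Fin n → M,
    g (Structure.funMap f x) = Structure.funMap f (g ∘ x)
  map_rel : ∀ (n : ℕ) (r : K.Relations n), ⟨n, r⟩ ∈ R → ∀ x : Fin n → M,
    Structure.RelMap r (g ∘ x) ↔ Structure.RelMap r x

theorem IsEmbeddingOn.realize_term {g : M → N} (hg : IsEmbeddingOn F R g) {α : Type*}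
    (t : K.Term α) (ht : termFunctions t ⊆ F) (x : α → M) :
    t.realize (g ∘ x) = g (t.realize x) := by
  induction t with
  | var => rfl
  | func f ts ih =>
    rw [termFunctions, Set.insert_subset_iff, Set.iUnion_subset_iff] at ht
    rw [Term.realize_func, Term.realize_func, hg.map_fun _ f ht.1]
    exact congrArg _ (funext fun i => ih i (ht.2 i))

/-- Quantifier-free formulas are invariant under embeddings for the symbols occurring in them. -/
theorem IsEmbeddingOn.realize_isQF {g : M → N} (hg : IsEmbeddingOn F R g) {α : Type*} {n : ℕ}
    {φ : K.BoundedFormula α n} (hφ : φ.IsQF) (hF : formulaFunctions φ ⊆ F)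
    (hR : formulaRelations φ ⊆ R) (x : α → M) (y : Fin n → M) :
    φ.Realize (g ∘ x) (g ∘ y) ↔ φ.Realize x y := by
  induction hφ with
  | falsum => rfl
  | of_isAtomic h =>
    cases h with
    | equal t₁ t₂ =>
      have hF' := Set.union_subset_iff.1 hF
      rw [BoundedFormula.realize_bdEqual, BoundedFormula.realize_bdEqual, ← Sum.comp_elim,
        hg.realize_term _ hF'.1, hg.realize_term _ hF'.2, hg.injective.eq_iff]
    | rel r ts =>
      have hF' := Set.iUnion_subset_iff.1 hF
      rw [BoundedFormula.realize_rel, BoundedFormula.realize_rel, ← Sum.comp_elim,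
        ← hg.map_rel _ r (hR rfl)]
      exact iff_of_eq (congrArg _ (funext fun i => hg.realize_term _ (hF' i) _))
  | imp _ _ ih₁ ih₂ =>
    have hF' := Set.union_subset_iff.1 hF
    have hR' := Set.union_subset_iff.1 hR
    rw [BoundedFormula.realize_imp, BoundedFormula.realize_imp, ih₁ hF'.1 hR'.1, ih₂ hF'.2 hR'.2]

/-- A ground formula whose symbols are in `F` and `R`. -/
structure IsGroundOver (F : Set (Σ n, K.Functions n)) (R : Set (Σ n, K.Relations n))
    (φ : K.Sentence) : Prop where
  ground : IsGround φ
  functions : formulaFunctions φ ⊆ F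
  relations : formulaRelations φ ⊆ R

theorem IsGroundOver.bot : IsGroundOver F R ⊥ :=
  ⟨BoundedFormula.isQF_bot, Set.empty_subset _, Set.empty_subset _⟩

theorem IsGroundOver.imp {φ ψ : K.Sentence} (hφ : IsGroundOver F R φ) (hψ : IsGroundOver F R ψ) :
    IsGroundOver F R (BoundedFormula.imp φ ψ) :=
  ⟨hφ.1.imp hψ.1, Set.union_subset hφ.2 hψ.2, Set.union_subset hφ.3 hψ.3⟩

theorem IsGroundOver.not {φ : K.Sentence} (hφ : IsGroundOver F R φ) :
    IsGroundOver F R φ.not :=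
  hφ.imp .bot

theorem IsGroundOver.inf {φ ψ : K.Sentence} (hφ : IsGroundOver F R φ) (hψ : IsGroundOver F R ψ) :
    IsGroundOver F R (φ ⊓ ψ) :=
  (hφ.imp hψ.not).not

/-- A finite set of ground formulas has a ground conjunction. -/
theorem exists_isGroundOver_conj (S : Finset K.Sentence) (hS : ∀ φ ∈ S, IsGroundOver F R φ) :
    ∃ ψ : K.Sentence, IsGroundOver F R ψ ∧
      ∀ (M : Type w) [K.Structure M], M ⊨ ψ ↔ ∀ φ ∈ S, M ⊨ φ := by
  classical
  induction S using Finset.induction_on with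
  | empty => exact ⟨_, IsGroundOver.bot.not, fun M _ => by simp [Sentence.Realize]⟩
  | insert φ S _ ih =>
    rw [Finset.forall_mem_insert] at hS
    obtain ⟨ψ, hψ, h⟩ := ih hS.2
    refine ⟨φ ⊓ ψ, hS.1.inf hψ, fun M _ => ?_⟩
    rw [Finset.forall_mem_insert, ← h M]
    exact Formula.realize_inf

/-- If a finite part of a set of ground formulas refutes `B` modulo `T`, so does a single ground
formula that follows from the set. -/
theorem exists_isGroundOver_of_models {T : K.Theory} {Γ : Set K.Sentence}
    (hΓ : ∀ φ ∈ Γ, IsGroundOver F R φ) {B : K.Sentence} (h : T ∪ Γ ⊨ᵇ B) :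
    ∃ ψ : K.Sentence, IsGroundOver F R ψ ∧
      (∀ (M : Type max u v) [K.Structure M], M ⊨ Γ → M ⊨ ψ) ∧ Entails T ψ B := by
  classical
  obtain ⟨T₀, hT₀, h₀⟩ := Theory.models_iff_finset_models.1 h
  obtain ⟨ψ, hψ, hr⟩ := exists_isGroundOver_conj.{u, v, max u v} (T₀.filter (· ∈ Γ))
    fun φ hφ => hΓ φ (Finset.mem_filter.1 hφ).2
  refine ⟨ψ, hψ, fun M _ hM => (hr M).2 fun φ hφ =>
    hM.realize_of_mem φ (Finset.mem_filter.1 hφ).2, Theory.models_sentence_iff.2 fun M => ?_⟩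
  refine fun hM => ?_
  have : M ⊨ (T₀ : K.Theory) := (Theory.model_iff _).2 fun φ hφ => (hT₀ hφ).elim
    (Theory.realize_sentence_of_mem T) fun h' => (hr M).1 hM φ (Finset.mem_filter.2 ⟨hφ, h'⟩)
  exact h₀.realize_sentence M

/-- If no ground formula over the given symbols separates `A` from `B` modulo `T`, then `A` and `B`
have models satisfying the same ground formulas over these symbols. -/
theorem exists_models_of_not_separated {T : K.Theory} {A B : K.Sentence}
    (h : ∀ φ, IsGroundOver F R φ → Entails T A φ → ¬ Entails T (B ⊓ φ) ⊥) :
    ∃ M N : Theory.ModelType.{u, v, max u v} T, M ⊨ A ∧ N ⊨ B ∧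
      ∀ φ, IsGroundOver F R φ → (M ⊨ φ ↔ N ⊨ φ) := by
  let Γ : Set K.Sentence := {φ | IsGroundOver F R φ ∧ Entails T A φ}
  have hB : ¬ T ∪ Γ ⊨ᵇ B.not := fun hB => by
    obtain ⟨ψ, hψ, hΓ, hψB⟩ := exists_isGroundOver_of_models (fun φ hφ => hφ.1) hB
    refine h ψ hψ (Theory.models_sentence_iff.2 fun M hA => hΓ M ?_)
      (Theory.models_sentence_iff.2 fun M hM => ?_)
    · exact (Theory.model_iff _).2 fun φ hφ => (hφ.2.realize_sentence M) hA
    · obtain ⟨h₁, h₂⟩ := Formula.realize_inf.1 hM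
      exact hψB.realize_sentence M h₂ h₁
  rw [Theory.models_sentence_iff, not_forall] at hB
  obtain ⟨N, hN⟩ := hB
  rw [Sentence.realize_not, not_not] at hN
  -- Δ is the ground theory of N. If some ψ following from Δ refuted A, then ¬ψ would lie in Γ and
  -- hold in N.
  let Δ : Set K.Sentence := {φ | IsGroundOver F R φ ∧ N ⊨ φ}
  have hA : ¬ T ∪ Δ ⊨ᵇ A.not := fun hA => by
    obtain ⟨ψ, hψ, hΔ, hψA⟩ := exists_isGroundOver_of_models (fun φ hφ => hφ.1) hA
    have hmem : ψ.not ∈ Γ := ⟨hψ.not, Theory.models_sentence_iff.2 fun M hM h' =>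
      hψA.realize_sentence M h' hM⟩
    have : N ⊨ ψ.not := Theory.realize_sentence_of_mem (T ∪ Γ) (Or.inr hmem)
    exact this (hΔ N ((Theory.model_iff _).2 fun φ hφ => hφ.2))
  rw [Theory.models_sentence_iff, not_forall] at hA
  obtain ⟨M, hM⟩ := hA
  rw [Sentence.realize_not, not_not] at hM
  refine ⟨M.subtheoryModel Set.subset_union_left, N.subtheoryModel Set.subset_union_left, hM, hN,
    fun φ hφ => ?_⟩
  have hΔ : ∀ ψ ∈ Δ, M ⊨ ψ := fun ψ hψ => Theory.realize_sentence_of_mem (T ∪ Δ) (Or.inr hψ)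
  exact ⟨fun h₁ => by_contra fun h₂ => hΔ φ.not ⟨hφ.not, h₂⟩ h₁, fun h₁ => hΔ φ ⟨hφ, h₁⟩⟩

/-- Some closed term over the function symbols in `F` has the value `a` in `M` and `b` in `N`. -/
def AreTermValues (F : Set (Σ n, K.Functions n)) (a : M) (b : N) : Prop :=
  ∃ t : K.Term (Empty ⊕ Fin 0), termFunctions t ⊆ F ∧
    t.realize (isEmptyElim : Empty ⊕ Fin 0 → M) = a ∧
    t.realize (isEmptyElim : Empty ⊕ Fin 0 → N) = b

theorem AreTermValues.funMap {n : ℕ} {f : K.Functions n} (hf : ⟨n, f⟩ ∈ F) {x : Fin n → M}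
    {y : Fin n → N} (h : ∀ i, AreTermValues F (x i) (y i)) :
    AreTermValues F (Structure.funMap f x) (Structure.funMap f y) := by
  choose t ht hx hy using h
  refine ⟨.func f t, Set.insert_subset hf (Set.iUnion_subset ht), ?_, ?_⟩
  · rw [Term.realize_func, funext hx]
  · rw [Term.realize_func, funext hy]

/-- An equation between closed terms is a ground formula. This later makes the map from S to M
injective and compatible with function symbols. -/
theorem AreTermValues.eq_iff (hMN : ∀ φ, IsGroundOver F R φ → (M ⊨ φ ↔ N ⊨ φ)) {a a' : M}
    {b b' : N} (h : AreTermValues F a b) (h' : AreTermValues F a' b') : a = a' ↔ b = b' := by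
  obtain ⟨t, ht, rfl, rfl⟩ := h
  obtain ⟨t', ht', rfl, rfl⟩ := h'
  have := hMN (t.bdEqual t') ⟨(BoundedFormula.IsAtomic.equal _ _).isQF,
    Set.union_subset ht ht', Set.empty_subset _⟩
  simpa only [Sentence.Realize, Formula.Realize, BoundedFormula.realize_bdEqual,
    eq_iff_true_of_subsingleton, Subsingleton.elim (Sum.elim default default) isEmptyElim] using this

theorem AreTermValues.relMap_iff (hMN : ∀ φ, IsGroundOver F R φ → (M ⊨ φ ↔ N ⊨ φ)) {n : ℕ}
    {r : K.Relations n} (hr : ⟨n, r⟩ ∈ R) {x : Fin n → M} {y : Fin n → N}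
    (h : ∀ i, AreTermValues F (x i) (y i)) : Structure.RelMap r x ↔ Structure.RelMap r y := by
  choose t ht hx hy using h
  have := hMN (r.boundedFormula t) ⟨(BoundedFormula.IsAtomic.rel _ _).isQF,
    Set.iUnion_subset ht, Set.singleton_subset_iff.2 hr⟩
  simpa only [Sentence.Realize, Formula.Realize, BoundedFormula.realize_rel,
    Subsingleton.elim (Sum.elim default default) isEmptyElim, hx, hy] using this

end Ground

/-! ### Gluing the uninterpreted symbols and the interpolation theorem -/

section Expansion

variable {L : FirstOrder.Language.{u, v}} {L' : FirstOrder.Language.{u', v'}} {M N D : Type w}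

/-- Two structures for an uninterpreted signature, placed inside a common set in such a way that
they agree on their intersection as far as the symbols in `FM ∩ FN` and `RM ∩ RN` are concerned,
extend to a structure on that set. -/
theorem exists_common_expansion [L'.Structure M] [L'.Structure N] [Nonempty D]
    {g : M → D} {f : N → D} (hg : Function.Injective g) (hf : Function.Injective f)
    {FM FN : Set (Σ n, L'.Functions n)} {RM RN : Set (Σ n, L'.Relations n)}
    (hF : ∀ (n : ℕ) (s : L'.Functions n), ⟨n, s⟩ ∈ FM ∩ FN → ∀ (x : Fin n → M) (y : Fin n → N),
      g ∘ x = f ∘ y → g (Structure.funMap s x) = f (Structure.funMap s y))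
    (hR : ∀ (n : ℕ) (r : L'.Relations n), ⟨n, r⟩ ∈ RM ∩ RN → ∀ (x : Fin n → M) (y : Fin n → N),
      g ∘ x = f ∘ y → (Structure.RelMap r x ↔ Structure.RelMap r y)) :
    ∃ _ : L'.Structure D, IsEmbeddingOn FM RM g ∧ IsEmbeddingOn FN RN f := by
  classical
  -- Symbols in FM follow M on tuples from M; otherwise N decides on tuples from N. A symbol outside
  -- FM thus follows N even on the overlap, where nothing is required for M.
  let S : L'.Structure D :=
    { funMap := fun {n} s z =>
        if h : ⟨n, s⟩ ∈ FM ∧ ∃ x, g ∘ x = z then g (Structure.funMap s h.2.choose)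
        else if h : ∃ y, f ∘ y = z then f (Structure.funMap s h.choose)
        else Classical.arbitrary D
      RelMap := fun {n} r z => (⟨n, r⟩ ∈ RM ∧ ∃ x, g ∘ x = z ∧ Structure.RelMap r x) ∨
        (⟨n, r⟩ ∈ RN ∧ ∃ y, f ∘ y = z ∧ Structure.RelMap r y) }
  refine ⟨S, ⟨hg, fun n s hs x => ?_, fun n r hr x => ?_⟩, ⟨hf, fun n s hs y => ?_,
    fun n r hr y => ?_⟩⟩
  · have h : ⟨n, s⟩ ∈ FM ∧ ∃ x', g ∘ x' = g ∘ x := ⟨hs, x, rfl⟩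
    refine Eq.trans ?_ (dif_pos h).symm
    rw [hg.comp_left h.2.choose_spec]
  · constructor
    · rintro (⟨_, x', hx', h⟩ | ⟨hr', y, hy, h⟩)
      · exact hg.comp_left hx' ▸ h
      · exact (hR n r ⟨hr, hr'⟩ x y hy.symm).2 h
    · exact fun h => Or.inl ⟨hr, x, rfl, h⟩
  · by_cases h : ⟨n, s⟩ ∈ FM ∧ ∃ x, g ∘ x = f ∘ y
    · refine Eq.trans ?_ (dif_pos h).symm
      exact (hF n s ⟨h.1, hs⟩ _ y h.2.choose_spec).symm
    · have h' : ∃ y', f ∘ y' = f ∘ y := ⟨y, rfl⟩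
      refine Eq.trans ?_ ((dif_neg h).trans (dif_pos h')).symm
      rw [hf.comp_left h'.choose_spec]
  · constructor
    · rintro (⟨hr', x, hx, h⟩ | ⟨_, y', hy', h⟩)
      · exact (hR n r ⟨hr', hr⟩ x y hx).1 h
      · exact hf.comp_left hy' ▸ h
    · exact fun h => Or.inr ⟨hr, y, rfl, h⟩

/-- The symbols of `L'` in a set of symbols of `L.sum L'`. -/
def restrictRight {X : ℕ → Type u} {Y : ℕ → Type u'} (F : Set (Σ n, X n ⊕ Y n)) : Set (Σ n, Y n) :=
  {s | ⟨s.1, Sum.inr s.2⟩ ∈ F}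

theorem IsEmbeddingOn.sum [L.Structure M] [L.Structure D] [L'.Structure M] [L'.Structure D]
    (g : M ↪[L] D) {F : Set (Σ n, (L.sum L').Functions n)} {R : Set (Σ n, (L.sum L').Relations n)}
    (h : IsEmbeddingOn (K := L') (restrictRight F) (restrictRight R) g) :
    IsEmbeddingOn (K := L.sum L') F R g := by
  refine ⟨h.injective, fun n s hs x => ?_, fun n r hr x => ?_⟩
  · cases s with
    | inl s => exact g.map_fun s x
    | inr s => exact h.map_fun n s hs x
  · cases r with
    | inl r => exact g.map_rel r x
    | inr r => exact h.map_rel n r hr x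

/-- Allows a model over the sum signature to be treated as carrying two separate structures, as
`exists_common_model` expects. -/
theorem sumStructure_reduct (S : (L.sum L').Structure M) :
    @Language.sumStructure L L' M ((LHom.sumInl : L →ᴸ L.sum L').reduct M)
      ((LHom.sumInr : L' →ᴸ L.sum L').reduct M) = S := by
  refine Structure.ext ?_ ?_
  · funext n s
    cases s <;> rfl
  · funext n r
    cases r <;> rfl

/-- The symbols of `L`, together with those in `F`. -/
def withLeft {X : ℕ → Type u} {Y : ℕ → Type u'} (F : Set (Σ n, X n ⊕ Y n)) :
    Set (Σ n, X n ⊕ Y n) :=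
  {s | ∀ y, s.2 = Sum.inr y → s ∈ F}

theorem withLeft_inl {X : ℕ → Type u} {Y : ℕ → Type u'} (F : Set (Σ n, X n ⊕ Y n)) {n : ℕ}
    (x : X n) : ⟨n, Sum.inl x⟩ ∈ withLeft F :=
  fun _ h => nomatch h

theorem withLeft_inr {X : ℕ → Type u} {Y : ℕ → Type u'} {F : Set (Σ n, X n ⊕ Y n)} {n : ℕ}
    {y : Y n} : ⟨n, Sum.inr y⟩ ∈ withLeft F ↔ ⟨n, Sum.inr y⟩ ∈ F :=
  ⟨fun h => h y rfl, fun h _ _ => h⟩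

/-- Models of `A` and of `B` that satisfy the same ground formulas over the common symbols can be
embedded into a single model of `A` and `B`. -/
theorem exists_common_model {T : L.Theory} (hU : IsUniversalTheory T)
    (hQE : AllowsQuantifierElimination T) {A B : (L.sum L').Sentence} (hA : IsGround A)
    (hB : IsGround B) [L.Structure M] [L.Structure N] [L'.Structure M] [L'.Structure N]
    [M ⊨ T] [N ⊨ T] (hMA : M ⊨ A) (hNB : N ⊨ B)
    (c : (L.sum L').Constants) (hc : ⟨0, c⟩ ∈ withLeft (formulaFunctions A ∩ formulaFunctions B))
    (hMN : ∀ φ, IsGroundOver (K := L.sum L') (withLeft (formulaFunctions A ∩ formulaFunctions B))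
      (withLeft (formulaRelations A ∩ formulaRelations B)) φ → (M ⊨ φ ↔ N ⊨ φ)) :
    ∃ (D : Type w) (_ : L.Structure D) (_ : L'.Structure D),
      Nonempty D ∧ D ⊨ T ∧ D ⊨ A ∧ D ⊨ B := by
  set F : Set (Σ n, (L.sum L').Functions n) := withLeft (formulaFunctions A ∩ formulaFunctions B)
  set R : Set (Σ n, (L.sum L').Relations n) := withLeft (formulaRelations A ∩ formulaRelations B)
  let S : L.Substructure N :=
    { carrier := {b | ∃ a : M, AreTermValues F a b}
      fun_mem := fun {n} s y hy => by
        choose x hx using hy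
        exact ⟨Structure.funMap s x,
          AreTermValues.funMap (f := (Sum.inl s : (L.sum L').Functions n)) (withLeft_inl _ s) hx⟩ }
  -- The constant c serves only to make S nonempty.
  have hne : Nonempty S := ⟨⟨_, _, AreTermValues.funMap (f := c) (x := (isEmptyElim : Fin 0 → M))
    (y := (isEmptyElim : Fin 0 → N)) hc isEmptyElim⟩⟩
  have hN : Nonempty N := hne.map Subtype.val
  choose h hh using fun b : S => (b.2 : ∃ a : M, AreTermValues F a (b : N))
  let h' : S ↪[L] M :=
    { toFun := h
      inj' := fun b b' hb => Subtype.ext (((hh b).eq_iff hMN (hh b')).1 hb)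
      map_fun' := fun {n} s y => ((hh _).eq_iff hMN
        (AreTermValues.funMap (f := (Sum.inl s : (L.sum L').Functions n)) (withLeft_inl _ s)
          fun i => hh (y i))).2 rfl
      map_rel' := fun {n} r y => AreTermValues.relMap_iff hMN
        (r := (Sum.inl r : (L.sum L').Relations n)) (withLeft_inl _ r) fun i => hh (y i) }
  have hS : S ⊨ T := by
    obtain ⟨V, hV, hTV, hVT⟩ := hU
    have : N ⊨ V := V.model_iff.2 fun φ hφ => (hTV φ hφ).realize_sentence N
    have : S ⊨ V := Theory.IsUniversal.models_of_embedding S.subtype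
    exact T.model_iff.2 fun φ hφ => (hVT φ hφ).realize_sentence S
  obtain ⟨D, hD, f, g, hDT, hagree, hinter⟩ := hQE.exists_strong_amalgam S h'
  -- Tuples identified in D come from S, so they are values of common terms and the ground formulas
  -- decide the common symbols on them.
  have hinter' : ∀ {n : ℕ} {x : Fin n → M} {y : Fin n → N}, g ∘ x = f ∘ y →
      ∀ i, AreTermValues F (x i) (y i) := fun hxy i => by
    obtain ⟨a, ha, ha'⟩ := hinter _ _ (congrFun hxy i).symm
    exact ha ▸ ha' ▸ hh a
  have hfg : ∀ {a b}, AreTermValues F a b → g a = f b := fun {a b} hab => by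
    rw [← ((hh ⟨b, a, hab⟩).eq_iff hMN hab).2 rfl]
    exact (hagree ⟨b, a, hab⟩).symm
  have hDne : Nonempty D := hN.map f
  obtain ⟨hD', hgM, hfN⟩ := exists_common_expansion (L' := L') g.injective f.injective
    (FM := restrictRight (formulaFunctions A)) (FN := restrictRight (formulaFunctions B))
    (RM := restrictRight (formulaRelations A)) (RN := restrictRight (formulaRelations B))
    (fun n s hs x y hxy => hfg (AreTermValues.funMap
      (f := (Sum.inr s : (L.sum L').Functions n)) (withLeft_inr.2 hs) (hinter' hxy)))
    (fun n r hr x y hxy => AreTermValues.relMap_iff hMN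
      (r := (Sum.inr r : (L.sum L').Relations n)) (withLeft_inr.2 hr) (hinter' hxy))
  refine ⟨D, hD, hD', hDne, hDT, ?_, ?_⟩
  · have := (IsEmbeddingOn.sum g hgM).realize_isQF hA subset_rfl subset_rfl default default
    rw [Subsingleton.elim (g ∘ default) default, Subsingleton.elim (g ∘ default) default] at this
    exact this.2 hMA
  · have := (IsEmbeddingOn.sum f hfN).realize_isQF hB subset_rfl subset_rfl default default
    rw [Subsingleton.elim (f ∘ default) default, Subsingleton.elim (f ∘ default) default] at this
    exact this.2 hNB

/-- Ground interpolation holds for formulas whose common signature has a constant symbol. -/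
theorem exists_isGeneralGroundInterpolant {T : L.Theory} (hU : IsUniversalTheory T)
    (hQE : AllowsQuantifierElimination T) {A B : (L.sum L').Sentence} (hA : IsGround A)
    (hB : IsGround B) (c : (L.sum L').Constants)
    (hc : ⟨0, c⟩ ∈ withLeft (formulaFunctions A ∩ formulaFunctions B))
    (hAB : Entails (withUIF T L') (A ⊓ B) ⊥) :
    ∃ I : (L.sum L').Sentence, IsGeneralGroundInterpolant T L' A B I := by
  by_contra hI
  obtain ⟨M, N, hMA, hNB, hMN⟩ := exists_models_of_not_separated
    (T := withUIF T L') (A := A) (B := B)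
    (F := withLeft (formulaFunctions A ∩ formulaFunctions B))
    (R := withLeft (formulaRelations A ∩ formulaRelations B))
    fun φ hφ h₁ h₂ => hI ⟨φ, hφ.ground, fun n f hf => withLeft_inr.1 (hφ.functions hf),
      fun n r hr => withLeft_inr.1 (hφ.relations hr), h₁, h₂⟩
  have key : ∃ (D : Type (max u u' v v')) (_ : L.Structure D) (_ : L'.Structure D),
      Nonempty D ∧ D ⊨ T ∧ D ⊨ A ∧ D ⊨ B := by
    obtain @⟨M, SM, hMT, _⟩ := M
    obtain @⟨N, SN, hNT, _⟩ := N
    let _ : L.Structure M := (LHom.sumInl : L →ᴸ L.sum L').reduct M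
    let _ : L'.Structure M := (LHom.sumInr : L' →ᴸ L.sum L').reduct M
    let _ : L.Structure N := (LHom.sumInl : L →ᴸ L.sum L').reduct N
    let _ : L'.Structure N := (LHom.sumInr : L' →ᴸ L.sum L').reduct N
    have : M ⊨ T := (LHom.onTheory_model LHom.sumInl T).1 hMT
    have : N ⊨ T := (LHom.onTheory_model LHom.sumInl T).1 hNT
    have hM := sumStructure_reduct (L := L) (L' := L') SM
    have hN := sumStructure_reduct (L := L) (L' := L') SN
    refine exists_common_model (M := M) (N := N) hU hQE hA hB ?_ ?_ c hc ?_
    · exact hM.symm ▸ hMA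
    · exact hN.symm ▸ hNB
    · rw [hM, hN]
      exact hMN
  obtain ⟨D, _, _, hDne, hDT, hDA, hDB⟩ := key
  have : D ⊨ withUIF T L' := (LHom.onTheory_model LHom.sumInl T).2 hDT
  exact hAB.realize_sentence D (Formula.realize_inf.2 ⟨hDA, hDB⟩)

end Expansion

end GroundInterpolation

theorem mainTheorem12 {L : FirstOrder.Language.{u, v}} (T : L.Theory)
    (hU : GroundInterpolation.IsUniversalTheory T)
    (hQE : GroundInterpolation.AllowsQuantifierElimination T) :
    (Nonempty L.Constants →
      GroundInterpolation.HasGeneralGroundInterpolation.{u, v, u', v'} T) ∧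
    ∀ (L' : FirstOrder.Language.{u', v'}) (A B : (L.sum L').Sentence),
      GroundInterpolation.IsGround A → GroundInterpolation.IsGround B →
      GroundInterpolation.ShareConstant L' A B →
      GroundInterpolation.Entails (GroundInterpolation.withUIF T L') (A ⊓ B) ⊥ →
        ∃ I : (L.sum L').Sentence,
          GroundInterpolation.IsGeneralGroundInterpolant T L' A B I := by
  -- A constant of Σ is always admissible in interpolants, so it plays the same role as a shared
  -- constant of Σ'.
  refine ⟨fun ⟨c⟩ L' A B hA hB hAB => ?_, fun L' A B hA hB ⟨c, hc⟩ hAB => ?_⟩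
  · exact GroundInterpolation.exists_isGeneralGroundInterpolant hU hQE hA hB (Sum.inl c)
      (GroundInterpolation.withLeft_inl _ c) hAB
  · exact GroundInterpolation.exists_isGeneralGroundInterpolant hU hQE hA hB (Sum.inr c)
      (GroundInterpolation.withLeft_inr.2 hc) hAB
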